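/- Let $G$ be a finitely generated amenable group, let $k$ be a skew field, and fix a finite generating set $X$ of $G$ with its left-invariant word metric $d$. For a finite set $F\subseteq G$ and $R>0$ put $\partial_R F=\{g\in G: d(g,F)\le R \text{ and } d(g,G\setminus F)\le R\}$ (with $d(g,\emptyset)=\infty$). A Følner sequence of $G$ is a sequence $(F_i)_{i\ge 0}$ of finite nonempty subsets of $G$ with $\lim_{i\to\infty}|\partial_R F_i|/|F_i|=0$ for every $R>0$. For a finitely generated left $kG$-module $M$, choose a surjective left $kG$-linear map $q\colon kG^n\to M$ and a Følner sequence $(E_i)_{i\ge 0}$. Let $M^*=\operatorname{Hom}_k(M,k)$ (left $k$-linear functionals, a right $k$-vector space), and let $q^*\colon M^*\to \operatorname{map}(G,k^n)$ be given by $q^*(\varphi)(g)=\bigl(\varphi(q(g e_1)),\dots,\varphi(q(g e_n))\bigr)$, where $e_1,\dots,e_n$ is the standard basis of $kG^n$. Elek's dimension of $M$ is $$\dim^{\mathrm{Elek}}_{kG}(M)=\limsup_{i\to\infty}\frac{\dim_k\bigl(\operatorname{im}(q^*)|_{E_i}\bigr)}{|E_i|},$$ where $V|_S\subseteq \operatorname{map}(S,k^n)$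 is the space of restrictions to $S$ of the elements of $V$, and $\dim_k$ is taken over $k$ acting from the right. For $S\subseteq G$ let $k[S]\subseteq kG$ be the $k$-subspace spanned by $S$, let $j[S]\colon k[S]\to kG$ be the inclusion, and let $\operatorname{pr}[S]\colon kG\to k[S]$ be the $k$-linear projection that is the identity on $S$ and sends $G\setminus S$ to $0$. **Theorem.** Let $M$ be a finitely presented left $kG$-module with a presentation, i.e. an exact sequence of left $kG$-modules $kG^r\xrightarrow{f}kG^s\xrightarrow{p}M\to 0$. For every subset $S\subseteq G$ define $$M[S]=\operatorname{coker}\bigl(\operatorname{pr}[S]\circ f\circ j[S]\colon k[S]^r\to k[S]^s\bigr).$$ Then for every Følner sequence $(F_i)_{i\ge 0}$ of $G$, whatever the choices of $n$, $q$ and $(E_i)$ made in the definition of $\dim^{\mathrm{Elek}}_{kG}(M)$, the following limit exists and $$\lim_{i\to\infty}\frac{\dim_k\bigl(M[F_i]\bigr)}{|F_i|}=\dim^{\mathrm{Elek}}_{kG}(M).$$ -/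

import Mathlib

open Filter Topology

noncomputable section

/-- A group is amenable if it carries a left-invariant finitely additive probability measure
defined on all its subsets. -/
def IsAmenableGroup (G : Type*) [Group G] : Prop :=
  ∃ μ : Set G → ℝ,
    (∀ A, 0 ≤ μ A) ∧ μ Set.univ = 1 ∧
    (∀ A B, Disjoint A B → μ (A ∪ B) = μ A + μ B) ∧
    ∀ (g : G) (A : Set G), μ ((fun x => g * x) '' A) = μ A

section WordMetric

variable {G : Type*} [Group G]

/-- The word length of `g` with respect to `X`: the least length of a word in letters from
`X ∪ X⁻¹` that represents `g`. (It is only used when `X` generates `G`.) -/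
def wordLength (X : Finset G) (g : G) : ℕ :=
  sInf {n | ∃ w : List G, w.length = n ∧ (∀ x ∈ w, x ∈ X ∨ x⁻¹ ∈ X) ∧ w.prod = g}

/-- The (left-invariant) word metric of `G` with respect to `X`. -/
def wordDist (X : Finset G) (g h : G) : ℕ := wordLength X (g⁻¹ * h)

/-- The `R`-boundary of `F`: all `g` with `d(g, F) ≤ R` and `d(g, G \ F) ≤ R`
(the distance to the empty set being infinite). -/
def folnerBoundary (X : Finset G) (R : ℝ) (F : Finset G) : Set G :=
  {g | (∃ h, h ∈ F ∧ (wordDist X g h : ℝ) ≤ R) ∧ ∃ h, h ∉ F ∧ (wordDist X g h : ℝ) ≤ R}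

/-- Følner sequences: finite nonempty subsets `F n` of `G` with
`|∂_R (F n)| / |F n| → 0` for every `R > 0`. -/
structure IsFolnerSequence (X : Finset G) (F : ℕ → Finset G) : Prop where
  nonempty : ∀ n, (F n).Nonempty
  tendsto_boundary : ∀ R : ℝ, 0 < R →
    Tendsto (fun n => ((folnerBoundary X R (F n)).ncard : ℝ) / ((F n).card : ℝ)) atTop (𝓝 0)

end WordMetric

section ElekDimension

variable {k G : Type*} [DivisionRing k] [Group G]

/-- The restriction map `map(G, k^n) → map(S, k^n)`, linear over `k` acting from the right. -/
def restrictTo (k : Type*) {G : Type*} [DivisionRing k] (n : ℕ) (S : Set G) :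
    (G → Fin n → k) →ₗ[kᵐᵒᵖ] (S → Fin n → k) where
  toFun φ x := φ x
  map_add' _ _ := rfl
  map_smul' _ _ := rfl

/-- The average dimension of a right `k`-linear subspace `V` of `map(G, k^n)` along the
sequence `F`: the upper limit of `dim_k (V|_{F i}) / |F i|`. Right `k`-vector spaces are
vector spaces over the opposite skew field. -/
def averageDim {n : ℕ} (F : ℕ → Finset G) (V : Submodule kᵐᵒᵖ (G → Fin n → k)) : ℝ :=
  limsup (fun i => (Module.finrank kᵐᵒᵖ (V.map (restrictTo k n (F i : Set G))) : ℝ) /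
    ((F i).card : ℝ)) atTop

variable {M : Type*} [AddCommGroup M] [Module k M] [Module (MonoidAlgebra k G) M]

/-- The map `q^* : M^* → (kG^n)^* = map(G, k^n)` dual to a `kG`-linear map `q : kG^n → M`.
Here `M^*` is the right `k`-vector space of left `k`-linear maps `M → k`, and a functional on
`kG^n` is identified with the function on `G` whose value at `g` lists its values on the basis
elements `g e_1, …, g e_n`. -/
def dualMap {n : ℕ} (q : (Fin n → MonoidAlgebra k G) →ₗ[MonoidAlgebra k G] M) :
    (M →ₗ[k] k) →ₗ[kᵐᵒᵖ] (G → Fin n → k) where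
  toFun φ g i := φ (q (Pi.single i (MonoidAlgebra.single g 1)))
  map_add' _ _ := rfl
  map_smul' _ _ := rfl

/-- Elek's dimension of `M`, computed from a surjection `q : kG^n → M` and a Følner sequence
`F`: the average dimension of the image of `q^*`. -/
def elekDim {n : ℕ} (F : ℕ → Finset G)
    (q : (Fin n → MonoidAlgebra k G) →ₗ[MonoidAlgebra k G] M) : ℝ :=
  averageDim F (LinearMap.range (dualMap q))

end ElekDimension

section Truncation

variable (k : Type*) {G : Type*} [DivisionRing k] [Group G]

/-- `k[S]`, the `k`-subspace of `kG` spanned by `S`. -/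
abbrev groupRingOn (S : Set G) : Submodule k (MonoidAlgebra k G) :=
  Submodule.span k ((fun g => MonoidAlgebra.single g (1 : k)) '' S)

/-- The inclusion `j[S]^r : k[S]^r → kG^r`. -/
def inclOn (S : Set G) (r : ℕ) :
    (Fin r → groupRingOn k S) →ₗ[k] (Fin r → MonoidAlgebra k G) :=
  (groupRingOn k S).subtype.compLeft (Fin r)

open scoped Classical in
/-- The projection `pr[S] : kG → k[S]`, which forgets the coefficients outside `S`. -/
def projOn (S : Set G) : MonoidAlgebra k G →ₗ[k] groupRingOn k S where
  toFun x := ⟨MonoidAlgebra.ofCoeff (x.coeff.filter (· ∈ S)), by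
    have h : MonoidAlgebra.ofCoeff (x.coeff.filter (· ∈ S)) ∈ MonoidAlgebra.supported k k S := by
      rw [MonoidAlgebra.mem_supported']
      intro m hm
      exact Finsupp.filter_apply_neg _ _ hm
    rwa [MonoidAlgebra.supported_eq_span_single] at h⟩
  map_add' x y := by
    apply Subtype.ext
    apply MonoidAlgebra.coeff_injective
    exact Finsupp.filter_add
  map_smul' a x := by
    apply Subtype.ext
    apply MonoidAlgebra.coeff_injective
    exact Finsupp.filter_smul

variable {k}

/-- The truncation `pr[S] ∘ f ∘ j[S] : k[S]^r → k[S]^s` of a `kG`-linear map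
`f : kG^r → kG^s`. -/
def truncation {r s : ℕ}
    (f : (Fin r → MonoidAlgebra k G) →ₗ[MonoidAlgebra k G] (Fin s → MonoidAlgebra k G))
    (S : Set G) : (Fin r → groupRingOn k S) →ₗ[k] (Fin s → groupRingOn k S) :=
  (projOn k S).compLeft (Fin s) ∘ₗ f.restrictScalars k ∘ₗ inclOn k S r

/-- `M[S]`, the cokernel of the truncation of the presentation map `f` to `S`. -/
abbrev truncatedCoker {r s : ℕ}
    (f : (Fin r → MonoidAlgebra k G) →ₗ[MonoidAlgebra k G] (Fin s → MonoidAlgebra k G))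
    (S : Set G) : Type _ :=
  (Fin s → groupRingOn k S) ⧸ LinearMap.range (truncation f S)

end Truncation

end

/-! For a surjection `q`, let rk(S) be the dimension of the span of the vectors q(g e_i) in M with g
in S. Dually, rk(E_i) is the numerator in Elek's dimension. As a function of S, rk is monotone,
submodular and invariant under left translation. Covering F by all translates gE, each point |E|
times, Shearer's inequality gives rk(F)/|F| ≤ rk(E)/|E| plus a boundary term. Hence rk(F_i)/|F_i|
tends to the infimum of rk(E)/|E| along every Følner sequence (`tendsto_familyRank`). Changing the
generators of M costs only a boundary term, so the infimum depends on M alone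
(`infRank_le_infRank`).

It remains to squeeze dim M[F] against the infimum for `p`. From below, it is at least rk(F) up to a
boundary term, because relations starting well inside F are not truncated. From above, dim M[F] is
at most the rank of k[F]^s modulo f(k[F]^r). Shearer's inequality applies to this rank as well: the
relations of M among the generators over a fixed E form a finite-dimensional space, so they come
from f(k[E']^r) with E' finite. For g well inside F, the translates of these relations lie in
f(k[F]^r), so gE contributes at most rk(E). -/

open Filter Topology

/-! ### Ranks of families of vectors -/

section FamilySpan

variable {k α ι V V₂ : Type*} [DivisionRing k] [AddCommGroup V] [Module k V]
  [AddCommGroup V₂] [Module k V₂]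

/-- The span of the vectors `v a i` with `a ∈ S`. -/
def familySpan (k : Type*) {α ι V : Type*} [DivisionRing k] [AddCommGroup V] [Module k V]
    (v : α → ι → V) (S : Set α) : Submodule k V :=
  Submodule.span k (Set.image2 v S Set.univ)

/-- The dimension of the span of the vectors `v a i` with `a ∈ S`. -/
noncomputable def familyRank (k : Type*) {α ι V : Type*} [DivisionRing k] [AddCommGroup V]
    [Module k V] (v : α → ι → V) (S : Set α) : ℕ :=
  Module.finrank k (familySpan k v S)

theorem mem_familySpan (v : α → ι → V) {S : Set α} {a : α} (ha : a ∈ S) (i : ι) :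
    v a i ∈ familySpan k v S :=
  Submodule.subset_span ⟨a, ha, i, trivial, rfl⟩

theorem familySpan_le {v : α → ι → V} {S : Set α} {W : Submodule k V} :
    familySpan k v S ≤ W ↔ ∀ a ∈ S, ∀ i, v a i ∈ W := by
  refine ⟨fun h a ha i => h (mem_familySpan v ha i), fun h => Submodule.span_le.2 ?_⟩
  rintro _ ⟨a, ha, i, -, rfl⟩
  exact h a ha i

theorem familySpan_mono (v : α → ι → V) {S T : Set α} (h : S ⊆ T) :
    familySpan k v S ≤ familySpan k v T :=
  familySpan_le.2 fun _ ha i => mem_familySpan v (h ha) i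

theorem familySpan_union (v : α → ι → V) (S T : Set α) :
    familySpan k v (S ∪ T) = familySpan k v S ⊔ familySpan k v T := by
  rw [familySpan, Set.image2_union_left, Submodule.span_union]; rfl

theorem map_familySpan (φ : V →ₗ[k] V₂) (v : α → ι → V) (S : Set α) :
    (familySpan k v S).map φ = familySpan k (fun a i => φ (v a i)) S := by
  rw [familySpan, Submodule.map_span, Set.image_image2]; rfl

instance finiteDimensional_familySpan [Finite ι] (v : α → ι → V) (S : Finset α) :
    FiniteDimensional k (familySpan k v (S : Set α)) :=
  FiniteDimensional.span_of_finite k (S.finite_toSet.image2 v Set.finite_univ)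

theorem familyRank_le_card [Fintype ι] (v : α → ι → V) (S : Finset α) :
    familyRank k v (S : Set α) ≤ Fintype.card ι * S.card := by
  classical
  have h : Set.image2 v (S : Set α) Set.univ = (Finset.image₂ v S Finset.univ : Finset V) := by
    simp
  rw [familyRank, familySpan, h]
  refine (finrank_span_finset_le_card _).trans ?_
  rw [mul_comm, ← Finset.card_univ]
  exact Finset.card_image₂_le _ _ _

theorem familyRank_mono [Finite ι] (v : α → ι → V) {S T : Finset α} (h : S ⊆ T) :
    familyRank k v (S : Set α) ≤ familyRank k v (T : Set α) :=
  Submodule.finrank_mono (familySpan_mono v (Finset.coe_subset.2 h))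

theorem familyRank_empty (v : α → ι → V) : familyRank k v (∅ : Set α) = 0 := by
  rw [familyRank, familySpan, Set.image2_empty_left, Submodule.span_empty, finrank_bot]

/-- Submodularity: the dimension formula for a sum of subspaces, with loss because the span over S ∩
T may be smaller than the intersection of the spans. -/
theorem familyRank_union_add_inter_le [Finite ι] [DecidableEq α] (v : α → ι → V)
    (S T : Finset α) :
    familyRank k v ((S ∪ T : Finset α) : Set α) + familyRank k v ((S ∩ T : Finset α) : Set α) ≤
      familyRank k v (S : Set α) + familyRank k v (T : Set α) := by
  have h : familySpan k v ((S ∩ T : Finset α) : Set α) ≤ familySpan k v (S : Set α) ⊓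
      familySpan k v (T : Set α) :=
    le_inf (familySpan_mono v (Finset.coe_subset.2 Finset.inter_subset_left))
      (familySpan_mono v (Finset.coe_subset.2 Finset.inter_subset_right))
  have h1 := Submodule.finrank_mono h
  have h2 := Submodule.finrank_sup_add_finrank_inf_eq (familySpan k v (S : Set α))
    (familySpan k v (T : Set α))
  rw [familyRank, familyRank, familyRank, familyRank, Finset.coe_union, familySpan_union, ← h2]
  exact Nat.add_le_add_left h1 _

/-- Shearer's inequality for ranks: if every point of `F` lies in at least `m` of the sets
`A c`, then `m` times the rank of `F` is at most the sum of the ranks of the `A c ∩ F`. -/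
theorem mul_familyRank_le_sum [Finite ι] [DecidableEq α] {γ : Type*} (v : α → ι → V)
    (I : Finset γ) (A : γ → Finset α) (m : ℕ) (F : Finset α)
    (hm : ∀ x ∈ F, m ≤ (I.filter (x ∈ A ·)).card) :
    m * familyRank k v (F : Set α) ≤ ∑ c ∈ I, familyRank k v ((A c ∩ F : Finset α) : Set α) := by
  induction F using Finset.induction_on with
  | empty => simp [familyRank_empty]
  | insert x F hx ih =>
    have ih' := ih fun y hy => hm y (Finset.mem_insert_of_mem hy)
    have hmono : familyRank k v (F : Set α) ≤ familyRank k v (insert x F : Finset α) :=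
      familyRank_mono v (Finset.subset_insert x F)
    -- Here d is the gain in rank when x joins F. By submodularity, x raises the rank of the smaller
    -- set A c ∩ F by at least d whenever x ∈ A c, which happens for at least m indices c.
    obtain ⟨d, hd⟩ := Nat.exists_eq_add_of_le hmono
    have key : ∀ c ∈ I, familyRank k v ((A c ∩ F : Finset α) : Set α) + (if x ∈ A c then d else 0) ≤
        familyRank k v ((A c ∩ insert x F : Finset α) : Set α) := by
      intro c _
      split_ifs with hc
      · have h := familyRank_union_add_inter_le (k := k) v (A c ∩ insert x F) F
        have h1 : A c ∩ insert x F ∪ F = insert x F := by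
          ext y; simp only [Finset.mem_union, Finset.mem_inter, Finset.mem_insert]; grind
        have h2 : A c ∩ insert x F ∩ F = A c ∩ F := by
          ext y; simp only [Finset.mem_inter, Finset.mem_insert]; grind
        rw [h1, h2] at h
        omega
      · exact familyRank_mono v
          (Finset.inter_subset_inter_left (Finset.subset_insert x F))
    calc m * familyRank k v (insert x F : Finset α)
        = m * familyRank k v (F : Set α) + m * d := by rw [hd, mul_add]
      _ ≤ ∑ c ∈ I, familyRank k v ((A c ∩ F : Finset α) : Set α) +
          (I.filter (x ∈ A ·)).card * d :=
        add_le_add ih' (Nat.mul_le_mul_right _ (hm x (Finset.mem_insert_self x F)))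
      _ = ∑ c ∈ I, (familyRank k v ((A c ∩ F : Finset α) : Set α) +
          (if x ∈ A c then d else 0)) := by
        rw [Finset.sum_add_distrib, ← Finset.sum_filter, Finset.sum_const, smul_eq_mul]
      _ ≤ _ := Finset.sum_le_sum key

theorem familyRank_le_add_sdiff [Fintype ι] [DecidableEq α] (v : α → ι → V) (S T : Finset α) :
    familyRank k v (T : Set α) ≤ familyRank k v (S : Set α) + Fintype.card ι * (T \ S).card := by
  have h1 := familyRank_mono (k := k) v
    (show T ⊆ S ∪ (T \ S) by rw [Finset.union_sdiff_self_eq_union]; exact Finset.subset_union_right)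
  have h2 := familyRank_union_add_inter_le (k := k) v S (T \ S)
  have h3 := familyRank_le_card (k := k) v (T \ S)
  omega

end FamilySpan

/-! ### Rank–nullity estimates, and duals over a skew field. -/

section LinearAlgebra

variable {k V V₁ V₂ : Type*} [DivisionRing k] [AddCommGroup V] [Module k V]
  [AddCommGroup V₁] [Module k V₁] [AddCommGroup V₂] [Module k V₂]

theorem finrank_map_le_of_ker_inf_le (π₁ : V →ₗ[k] V₁) (π₂ : V →ₗ[k] V₂) (W : Submodule k V)
    [FiniteDimensional k W] (h : LinearMap.ker π₁ ⊓ W ≤ LinearMap.ker π₂) :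
    Module.finrank k (W.map π₂) ≤ Module.finrank k (W.map π₁) := by
  have h1 := LinearMap.finrank_range_add_finrank_ker (π₁.domRestrict W)
  have h2 := LinearMap.finrank_range_add_finrank_ker (π₂.domRestrict W)
  rw [LinearMap.range_domRestrict] at h1 h2
  have h3 : LinearMap.ker (π₁.domRestrict W) ≤ LinearMap.ker (π₂.domRestrict W) :=
    fun x hx => h ⟨hx, x.2⟩
  have h4 := Submodule.finrank_mono h3
  omega

theorem finrank_quotient_le_finrank_range [FiniteDimensional k V] (φ : V →ₗ[k] V₂)
    (L : Submodule k V) (h : LinearMap.ker φ ≤ L) :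
    Module.finrank k (V ⧸ L) ≤ Module.finrank k (LinearMap.range φ) := by
  have h1 := LinearMap.finrank_range_add_finrank_ker φ
  have h2 := Submodule.finrank_quotient_add_finrank L
  have h3 := Submodule.finrank_mono h
  omega

/-- The map ψ induces a surjection from V/L onto range ψ / ψ(L). -/
theorem finrank_range_le_finrank_quotient_add [FiniteDimensional k V] (ψ : V →ₗ[k] V₂)
    (L : Submodule k V) :
    Module.finrank k (LinearMap.range ψ) ≤
      Module.finrank k (V ⧸ L) + Module.finrank k (L.map ψ) := by
  have h1 := LinearMap.finrank_range_add_finrank_ker ψ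
  have h2 := Submodule.finrank_quotient_add_finrank L
  have h3 := LinearMap.finrank_range_add_finrank_ker (ψ.domRestrict L)
  rw [LinearMap.range_domRestrict] at h3
  have h4 : Module.finrank k (LinearMap.ker (ψ.domRestrict L)) ≤
      Module.finrank k (LinearMap.ker ψ) := by
    have : (LinearMap.ker (ψ.domRestrict L)).map L.subtype ≤ LinearMap.ker ψ := by
      rintro _ ⟨x, hx, rfl⟩
      exact hx
    have h5 := Submodule.finrank_mono this
    rwa [Submodule.finrank_map_subtype_eq] at h5
  omega

theorem finrank_mulOpposite_self (k : Type*) [DivisionRing k] :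
    Module.finrank kᵐᵒᵖ k = 1 := by
  let e : k ≃ₗ[kᵐᵒᵖ] kᵐᵒᵖ :=
    { MulOpposite.opAddEquiv with
      map_smul' := fun a x => by
        simp [MulOpposite.smul_eq_mul_unop] }
  rw [e.finrank_eq, Module.finrank_self]

theorem finrank_mulOpposite_dual (V : Type*) [AddCommGroup V] [Module k V]
    [FiniteDimensional k V] :
    Module.finrank kᵐᵒᵖ (V →ₗ[k] k) = Module.finrank k V := by
  let b := Module.finBasis k V
  have : Module.Finite kᵐᵒᵖ k :=
    Module.finite_of_finrank_eq_succ (n := 0) (finrank_mulOpposite_self k)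
  rw [← (b.constr kᵐᵒᵖ (M' := k)).finrank_eq, Module.finrank_pi_fintype]
  simp [finrank_mulOpposite_self]

end LinearAlgebra

/-! ### Boundaries and Følner sequences -/

section Boundary

variable {G : Type*} [Group G]

/-- The points of `F` or of `F * B` that are moved across the border of `F` by an element of
`B` or its inverse. -/
def mulBoundary [DecidableEq G] (B F : Finset G) : Finset G :=
  F.filter (fun g => ∃ b ∈ B, g * b ∉ F) ∪ (Finset.image₂ (· * ·) F B \ F)

theorem wordLength_one (X : Finset G) : wordLength X 1 = 0 :=
  Nat.sInf_eq_zero.2 (Or.inl ⟨[], rfl, by simp, rfl⟩)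

theorem exists_word (X : Finset G) (hX : Subgroup.closure (X : Set G) = ⊤) (g : G) :
    ∃ w : List G, w.length = wordLength X g ∧ (∀ x ∈ w, x ∈ X ∨ x⁻¹ ∈ X) ∧ w.prod = g := by
  refine Nat.sInf_mem (s := {n | ∃ w : List G, w.length = n ∧ (∀ x ∈ w, x ∈ X ∨ x⁻¹ ∈ X) ∧
    w.prod = g}) ?_
  have hg : g ∈ (Subgroup.closure (X : Set G)).toSubmonoid := by rw [hX]; trivial
  rw [Subgroup.closure_toSubmonoid] at hg
  obtain ⟨w, hw, rfl⟩ := Submonoid.exists_list_of_mem_closure hg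
  exact ⟨w.length, w, rfl, fun x hx => by simpa using hw x hx, rfl⟩

variable [DecidableEq G]

theorem finite_setOf_wordLength_le (X : Finset G) (hX : Subgroup.closure (X : Set G) = ⊤)
    (n : ℕ) : {g | wordLength X g ≤ n}.Finite := by
  let Y : Finset G := X ∪ X.image (·⁻¹)
  refine ((List.finite_length_le Y n).image fun l => (l.map Subtype.val).prod).subset ?_
  intro g hg
  obtain ⟨w, hw, hwX, hwg⟩ := exists_word X hX g
  have hY : ∀ x ∈ w, x ∈ Y := fun x hx => by
    rcases hwX x hx with h | h
    · exact Finset.mem_union_left _ h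
    · exact Finset.mem_union_right _ (Finset.mem_image.2 ⟨_, h, inv_inv x⟩)
  lift w to List Y using hY
  exact ⟨w, by simpa [← hw] using hg, hwg⟩

/-- Word balls are finite, so a boundary is too. This matters because `Set.ncard` of an infinite set
is 0, which would make the Følner condition say nothing. -/
theorem finite_folnerBoundary (X : Finset G) (hX : Subgroup.closure (X : Set G) = ⊤)
    (R : ℝ) (F : Finset G) : (folnerBoundary X R F).Finite := by
  refine (F.finite_toSet.image2 (fun h x => h * x⁻¹)
    (finite_setOf_wordLength_le X hX ⌊R⌋₊)).subset ?_
  rintro g ⟨⟨h, hF, hR⟩, -⟩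
  exact ⟨h, hF, g⁻¹ * h, Nat.le_floor hR, by group⟩

theorem IsFolnerSequence.tendsto_mulBoundary {X : Finset G}
    (hX : Subgroup.closure (X : Set G) = ⊤) {F : ℕ → Finset G} (hF : IsFolnerSequence X F)
    (B : Finset G) :
    Tendsto (fun i => ((mulBoundary B (F i)).card : ℝ) / (F i).card) atTop (𝓝 0) := by
  -- A radius covering all letters of B and their inverses: then `mulBoundary B` lies in the metric
  -- boundary. The radius used is N + 1 because the Følner condition asks for R > 0.
  let N : ℕ := (B ∪ B.image (·⁻¹)).sup (wordLength X)
  have hN : ∀ b ∈ B, wordLength X b ≤ N ∧ wordLength X b⁻¹ ≤ N := fun b hb =>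
    ⟨Finset.le_sup (Finset.mem_union_left _ hb),
      Finset.le_sup (Finset.mem_union_right _ (Finset.mem_image_of_mem _ hb))⟩
  refine squeeze_zero (fun i => by positivity) (fun i => ?_)
    (hF.tendsto_boundary (N + 1) (by positivity))
  gcongr
  rw [← Set.ncard_coe_finset]
  refine Set.ncard_le_ncard ?_ (finite_folnerBoundary X hX _ _)
  have hd : ∀ g h : G, wordLength X (g⁻¹ * h) ≤ N → (wordDist X g h : ℝ) ≤ N + 1 :=
    fun g h hgh => by
      have : (wordDist X g h : ℝ) ≤ N := by exact_mod_cast hgh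
      linarith
  have h0 : ∀ g : G, wordLength X (g⁻¹ * g) ≤ N := fun g => by
    rw [inv_mul_cancel, wordLength_one]; exact Nat.zero_le _
  intro g hg
  simp only [mulBoundary, Finset.coe_union, Set.mem_union, Finset.mem_coe, Finset.mem_filter,
    Finset.mem_sdiff, Finset.mem_image₂] at hg
  rcases hg with ⟨hg, b, hb, hgb⟩ | ⟨⟨h, hh, b, hb, rfl⟩, hg⟩
  · exact ⟨⟨g, hg, hd _ _ (h0 g)⟩, g * b, hgb, hd _ _ (by simpa using (hN b hb).1)⟩
  · exact ⟨⟨h, hh, hd _ _ (by simpa using (hN b hb).2)⟩, h * b, hg, hd _ _ (h0 _)⟩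

end Boundary

/-- A sequence that lies asymptotically below each term of a family and above its
infimum converges to that infimum. -/
theorem tendsto_iInf_of_le_add {ι : Type*} [Nonempty ι] {a : ι → ℝ}
    {u : ℕ → ℝ} (hup : ∀ j, ∃ e : ℕ → ℝ, Tendsto e atTop (𝓝 0) ∧ ∀ i, u i ≤ a j + e i)
    (hlow : ∃ e : ℕ → ℝ, Tendsto e atTop (𝓝 0) ∧ ∀ i, (⨅ j, a j) - e i ≤ u i) :
    Tendsto u atTop (𝓝 (⨅ j, a j)) := by
  refine tendsto_order.2 ⟨fun b hb => ?_, fun b hb => ?_⟩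
  · obtain ⟨e, he, h⟩ := hlow
    filter_upwards [he.eventually_lt_const (sub_pos.2 hb)] with i hi
    linarith [h i]
  · obtain ⟨j, hj⟩ := exists_lt_of_ciInf_lt hb
    obtain ⟨e, he, h⟩ := hup j
    filter_upwards [he.eventually_lt_const (sub_pos.2 hj)] with i hi
    linarith [h i]

/-! ### Free modules over the group ring -/

section GroupRingOn

variable {k G : Type*} [DivisionRing k]

theorem finite_groupRingOn (F : Finset G) :
    FiniteDimensional k (groupRingOn k (F : Set G)) :=
  FiniteDimensional.span_of_finite k (F.finite_toSet.image _)

theorem projOn_eq_self {S : Set G} {x : MonoidAlgebra k G} (hx : x ∈ groupRingOn k S) :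
    (projOn k S x : MonoidAlgebra k G) = x := by
  rw [groupRingOn, ← MonoidAlgebra.supported_eq_span_single, MonoidAlgebra.mem_supported'] at hx
  apply MonoidAlgebra.coeff_injective
  ext g
  classical
  by_cases hg : g ∈ S
  · exact Finsupp.filter_apply_pos _ _ hg
  · exact (Finsupp.filter_apply_neg _ _ hg).trans (hx g hg).symm

end GroupRingOn

section FreeModule

variable {k G : Type*} [DivisionRing k] [Group G]

/-- The elements `g e_i` of `kG^n`. -/
noncomputable def freeGen (k : Type*) {G : Type*} [DivisionRing k] [Group G] (n : ℕ) (g : G)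
    (i : Fin n) : Fin n → MonoidAlgebra k G :=
  Pi.single i (MonoidAlgebra.single g 1)

theorem mem_familySpan_freeGen {n : ℕ} {S : Set G} {x : Fin n → MonoidAlgebra k G} :
    x ∈ familySpan k (freeGen k n) S ↔ ∀ i, x i ∈ groupRingOn k S := by
  constructor
  · intro hx i
    have h : familySpan k (freeGen k n) S ≤
        (groupRingOn k S).comap (LinearMap.proj i) := by
      refine familySpan_le.2 fun g hg j => ?_
      rcases eq_or_ne i j with rfl | hij
      · simpa [freeGen] using Submodule.subset_span (Set.mem_image_of_mem _ hg)
      · simp [freeGen, Pi.single_eq_of_ne hij]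
    exact h hx
  · intro hx
    rw [← Finset.univ_sum_single x]
    refine Submodule.sum_mem _ fun i _ => ?_
    have h : groupRingOn k S ≤ (familySpan k (freeGen k n) S).comap
        (LinearMap.single k (fun _ : Fin n => MonoidAlgebra k G) i) := by
      refine Submodule.span_le.2 ?_
      rintro _ ⟨g, hg, rfl⟩
      exact mem_familySpan (freeGen k n) hg i
    exact h (hx i)

theorem range_inclOn (S : Set G) (n : ℕ) :
    LinearMap.range (inclOn k S n) = familySpan k (freeGen k n) S := by
  ext x
  rw [mem_familySpan_freeGen]
  constructor
  · rintro ⟨y, rfl⟩ i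
    exact (y i).2
  · intro h
    exact ⟨fun i => ⟨x i, h i⟩, rfl⟩

theorem exists_mem_familySpan_freeGen [DecidableEq G] {n : ℕ} (x : Fin n → MonoidAlgebra k G) :
    ∃ B : Finset G, x ∈ familySpan k (freeGen k n) (B : Set G) := by
  refine ⟨Finset.univ.biUnion fun i => (x i).coeff.support, ?_⟩
  rw [mem_familySpan_freeGen]
  intro i
  rw [groupRingOn, ← MonoidAlgebra.supported_eq_span_single, MonoidAlgebra.mem_supported]
  exact Finset.coe_subset.2
    (Finset.subset_biUnion_of_mem (fun i => (x i).coeff.support) (Finset.mem_univ i))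

theorem exists_forall_mem_familySpan_freeGen [DecidableEq G] {n m : ℕ}
    (y : Fin m → Fin n → MonoidAlgebra k G) :
    ∃ B : Finset G, ∀ i, y i ∈ familySpan k (freeGen k n) (B : Set G) := by
  choose B hB using fun i => exists_mem_familySpan_freeGen (y i)
  exact ⟨Finset.univ.biUnion B, fun i => familySpan_mono _
    (Finset.coe_subset.2 (Finset.subset_biUnion_of_mem B (Finset.mem_univ i))) (hB i)⟩

/-! ### Translation by group elements. -/

section Translate

variable {M : Type*} [AddCommGroup M] [Module k M] [Module (MonoidAlgebra k G) M]
  [IsScalarTower k (MonoidAlgebra k G) M]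

/-- The action of a group element on a `kG`-module, as a `k`-linear automorphism. -/
noncomputable def groupTranslate (k : Type*) {G : Type*} [DivisionRing k] [Group G] (M : Type*)
    [AddCommGroup M] [Module k M] [Module (MonoidAlgebra k G) M]
    [IsScalarTower k (MonoidAlgebra k G) M] (g : G) : M ≃ₗ[k] M where
  toFun x := MonoidAlgebra.single g (1 : k) • x
  invFun x := MonoidAlgebra.single g⁻¹ (1 : k) • x
  map_add' x y := smul_add _ x y
  map_smul' a x := by
    -- The scalar a acts as the group ring element a·1, which commutes with 1·g although k need not
    -- be commutative.
    have h : ∀ z : M, a • z = (MonoidAlgebra.single (1 : G) a : MonoidAlgebra k G) • z := by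
      intro z
      rw [← smul_one_smul (MonoidAlgebra k G) a z, MonoidAlgebra.one_def,
        MonoidAlgebra.smul_single, smul_eq_mul, mul_one]
    simp [h, smul_smul, MonoidAlgebra.single_mul_single]
  left_inv x := by
    simp [smul_smul, MonoidAlgebra.single_mul_single, ← MonoidAlgebra.one_def]
  right_inv x := by
    simp [smul_smul, MonoidAlgebra.single_mul_single, ← MonoidAlgebra.one_def]

theorem map_groupTranslate {N : Type*} [AddCommGroup N] [Module k N] [Module (MonoidAlgebra k G) N]
    [IsScalarTower k (MonoidAlgebra k G) N] (f : M →ₗ[MonoidAlgebra k G] N) (g : G) (x : M) :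
    f (groupTranslate k M g x) = groupTranslate k N g (f x) :=
  f.map_smul _ x

theorem groupTranslate_freeGen {n : ℕ} (g h : G) (i : Fin n) :
    groupTranslate k (Fin n → MonoidAlgebra k G) g (freeGen k n h i) = freeGen k n (g * h) i := by
  change MonoidAlgebra.single g (1 : k) • (Pi.single i _ : Fin n → MonoidAlgebra k G) = _
  rw [← Pi.single_smul]
  simp [freeGen, MonoidAlgebra.single_mul_single]

theorem groupTranslate_mem_familySpan {n : ℕ} {S T : Set G} (g : G) (h : ∀ x ∈ S, g * x ∈ T)
    {y : Fin n → MonoidAlgebra k G} (hy : y ∈ familySpan k (freeGen k n) S) :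
    groupTranslate k (Fin n → MonoidAlgebra k G) g y ∈ familySpan k (freeGen k n) T := by
  have : familySpan k (freeGen k n) S ≤ (familySpan k (freeGen k n) T).comap
      (groupTranslate k (Fin n → MonoidAlgebra k G) g).toLinearMap := by
    refine familySpan_le.2 fun x hx i => ?_
    rw [Submodule.mem_comap, LinearEquiv.coe_coe, groupTranslate_freeGen]
    exact mem_familySpan _ (h x hx) i
  exact this hy

/-- The images `q (g e_i)` in `M` of the elements `g e_i` of `kG^n`. -/
noncomputable def genImage {n : ℕ} (q : (Fin n → MonoidAlgebra k G) →ₗ[MonoidAlgebra k G] M)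
    (g : G) (i : Fin n) : M :=
  q (freeGen k n g i)

theorem familySpan_genImage {n : ℕ}
    (q : (Fin n → MonoidAlgebra k G) →ₗ[MonoidAlgebra k G] M) (S : Set G) :
    familySpan k (genImage q) S = (familySpan k (freeGen k n) S).map (q.restrictScalars k) :=
  (map_familySpan (q.restrictScalars k) (freeGen k n) S).symm

theorem groupTranslate_genImage {n : ℕ}
    (q : (Fin n → MonoidAlgebra k G) →ₗ[MonoidAlgebra k G] M) (g h : G) (i : Fin n) :
    groupTranslate k M g (genImage q h i) = genImage q (g * h) i := by
  rw [genImage, ← map_groupTranslate, groupTranslate_freeGen]; rfl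

theorem familyRank_genImage_translate [DecidableEq G] {n : ℕ}
    (q : (Fin n → MonoidAlgebra k G) →ₗ[MonoidAlgebra k G] M) (g : G) (E : Finset G) :
    familyRank k (genImage q) ((E.image (g * ·) : Finset G) : Set G) =
      familyRank k (genImage q) (E : Set G) := by
  have h : familySpan k (genImage q) ((E.image (g * ·) : Finset G) : Set G) =
      (familySpan k (genImage q) (E : Set G)).map (groupTranslate k M g).toLinearMap := by
    rw [map_familySpan]
    simp only [LinearEquiv.coe_coe, groupTranslate_genImage]
    rw [familySpan, familySpan, Finset.coe_image, Set.image2_image_left]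
  rw [familyRank, h]
  exact (LinearEquiv.finrank_map_eq (groupTranslate k M g) _)

end Translate

end FreeModule

/-! ### Shearer's inequality for translates of a finite set. -/

section Tiling

variable {k G : Type*} [DivisionRing k] [Group G] [DecidableEq G]
  {V : Type*} [AddCommGroup V] [Module k V]

/-- Shearer's inequality for the covering of `F` by translates of `E`. -/
theorem card_mul_familyRank_le_sum {n : ℕ} (v : G → Fin n → V) (E F I : Finset G)
    (hI : ∀ x ∈ F, ∀ e ∈ E, x * e⁻¹ ∈ I) :
    E.card * familyRank k v (F : Set G) ≤
      ∑ g ∈ I, familyRank k v ((E.image (g * ·) ∩ F : Finset G) : Set G) := by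
  refine mul_familyRank_le_sum v I (fun g => E.image (g * ·)) E.card F fun x hx => ?_
  -- The translates gE containing x are those with g = x e⁻¹, one for each e in E.
  rw [← Finset.card_image_of_injective E
    (fun a b h => inv_injective (mul_left_cancel h) : Function.Injective fun e => x * e⁻¹)]
  refine Finset.card_le_card fun y hy => ?_
  obtain ⟨e, he, rfl⟩ := Finset.mem_image.1 hy
  exact Finset.mem_filter.2 ⟨hI x hx e he, Finset.mem_image.2 ⟨e, he, by group⟩⟩

/-- If `B` contains `E` and `E⁻¹`, then up to an error controlled by the `B`-boundary of `F`
the rank of `F` per point is at most the average of those of the translates `gE ⊆ F`. -/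
theorem card_mul_familyRank_le {n : ℕ} (v : G → Fin n → V) (E F B : Finset G) (c : ℕ)
    (hE : ∀ e ∈ E, e⁻¹ ∈ B)
    (hc : ∀ g ∈ F, (∀ b ∈ B, g * b ∈ F) → familyRank k v ((E.image (g * ·) ∩ F : Finset G) : Set G) ≤ c) :
    E.card * familyRank k v (F : Set G) ≤
      F.card * c + (mulBoundary B F).card * (n * E.card) := by
  have h := card_mul_familyRank_le_sum (k := k) v E F (F ∪ mulBoundary B F) fun x hx e he => by
    by_cases hxe : x * e⁻¹ ∈ F
    · exact Finset.mem_union_left _ hxe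
    · exact Finset.mem_union_right _ (Finset.mem_union_right _ (Finset.mem_sdiff.2
        ⟨Finset.mem_image₂_of_mem hx (hE e he), hxe⟩))
  refine h.trans ?_
  have h1 : ∀ g, familyRank k v ((E.image (g * ·) ∩ F : Finset G) : Set G) ≤ n * E.card := fun g => by
    refine (familyRank_le_card v _).trans ?_
    rw [Fintype.card_fin]
    exact Nat.mul_le_mul_left n
      ((Finset.card_le_card Finset.inter_subset_left).trans Finset.card_image_le)
  have h2 : F ∪ mulBoundary B F = (F \ mulBoundary B F) ∪ mulBoundary B F := by
    rw [Finset.sdiff_union_self_eq_union]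
  -- For g off the boundary, gB ⊆ F and the bound c applies; each boundary index costs at most the
  -- trivial bound n|E|.
  rw [h2, Finset.sum_union Finset.sdiff_disjoint]
  refine add_le_add ?_ (Finset.sum_le_card_nsmul _ _ _ fun g _ => h1 g)
  refine (Finset.sum_le_card_nsmul _ _ c fun g hg => ?_).trans ?_
  · rw [Finset.mem_sdiff, mulBoundary, Finset.mem_union, Finset.mem_filter] at hg
    refine hc g hg.1 fun b hb => ?_
    by_contra hgb
    exact hg.2 (Or.inl ⟨hg.1, b, hb, hgb⟩)
  · exact Nat.mul_le_mul_right c (Finset.card_le_card Finset.sdiff_subset)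

end Tiling

theorem div_le_div_add_of_card_mul_le {a b c d e n : ℕ} (he : 0 < e) (hd : 0 < d)
    (h : e * a ≤ d * c + b * (n * e)) :
    (a : ℝ) / d ≤ c / e + n * ((b : ℝ) / d) := by
  have he' : (0 : ℝ) < e := by exact_mod_cast he
  have hd' : (0 : ℝ) < d := by exact_mod_cast hd
  have h' : (e : ℝ) * a ≤ d * c + b * (n * e) := by exact_mod_cast h
  have h1 : (c : ℝ) / e + n * ((b : ℝ) / d) = (d * c + b * (n * e)) / (e * d) := by
    field_simp
  rw [h1, div_le_div_iff₀ hd' (by positivity)]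
  nlinarith

/-! ### Elek's dimension as an infimum of normalized ranks. -/

section Dimension

variable {k G : Type*} [DivisionRing k] [Group G]
  {M : Type*} [AddCommGroup M] [Module k M] [Module (MonoidAlgebra k G) M]

/-- Restricting the functionals in the image of `q^*` to `S` gives a space dual to the span of
the `q (g e_i)` with `g ∈ S`. -/
theorem finrank_map_restrictTo_range_dualMap {n : ℕ}
    (q : (Fin n → MonoidAlgebra k G) →ₗ[MonoidAlgebra k G] M) (S : Finset G) :
    Module.finrank kᵐᵒᵖ ((LinearMap.range (dualMap q)).map (restrictTo k n (S : Set G))) =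
      familyRank k (genImage q) (S : Set G) := by
  let W := familySpan k (genImage q) (S : Set G)
  let Φ : (W →ₗ[k] k) →ₗ[kᵐᵒᵖ] (↥(S : Set G) → Fin n → k) :=
    { toFun := fun φ x i => φ ⟨genImage q x i, mem_familySpan _ x.2 i⟩
      map_add' := fun _ _ => rfl
      map_smul' := fun _ _ => rfl }
  have hinj : Function.Injective Φ := by
    intro φ ψ h
    have hspan : W ≤ (LinearMap.eqLocus φ ψ).map W.subtype := by
      refine familySpan_le.2 fun g hg i => ⟨⟨genImage q g i, mem_familySpan _ hg i⟩, ?_, rfl⟩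
      exact congrFun (congrFun h ⟨g, hg⟩) i
    ext x
    obtain ⟨y, hy, hyx⟩ := hspan x.2
    obtain rfl : y = x := Subtype.ext hyx
    exact hy
  have hrange : (LinearMap.range (dualMap q)).map (restrictTo k n (S : Set G)) =
      LinearMap.range Φ := by
    apply le_antisymm
    · rintro _ ⟨_, ⟨φ, rfl⟩, rfl⟩
      exact ⟨φ.domRestrict W, rfl⟩
    · rintro _ ⟨φ, rfl⟩
      -- Every functional on the subspace W extends to M, so restriction loses no functional on W.
      obtain ⟨ψ, hψ⟩ := LinearMap.exists_extend φ
      refine ⟨dualMap q ψ, ⟨ψ, rfl⟩, ?_⟩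
      rw [← hψ]
      rfl
  rw [hrange, ← (LinearEquiv.ofInjective Φ hinj).finrank_eq, finrank_mulOpposite_dual]
  rfl

/-- The infimum over all finite nonempty sets `E` of the normalized rank of the `q (g e_i)`,
`g ∈ E`. -/
noncomputable def infRank {n : ℕ} (q : (Fin n → MonoidAlgebra k G) →ₗ[MonoidAlgebra k G] M) : ℝ :=
  ⨅ E : {E : Finset G // E.Nonempty}, (familyRank k (genImage q) (E.1 : Set G) : ℝ) / E.1.card

theorem infRank_le {n : ℕ} (q : (Fin n → MonoidAlgebra k G) →ₗ[MonoidAlgebra k G] M)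
    {E : Finset G} (hE : E.Nonempty) :
    infRank q ≤ (familyRank k (genImage q) (E : Set G) : ℝ) / E.card :=
  ciInf_le (f := fun E : {E : Finset G // E.Nonempty} =>
    (familyRank k (genImage q) (E.1 : Set G) : ℝ) / E.1.card)
    ⟨0, by rintro _ ⟨E, rfl⟩; positivity⟩ ⟨E, hE⟩

instance : Nonempty {E : Finset G // E.Nonempty} := ⟨⟨{1}, Finset.singleton_nonempty 1⟩⟩

variable [IsScalarTower k (MonoidAlgebra k G) M] {X : Finset G}

/-- The lower bound needs no error term, since each F i competes in the infimum. For the upper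
bound, translation invariance bounds every rank of gE ∩ F by that of E. -/
theorem IsFolnerSequence.tendsto_familyRank (hX : Subgroup.closure (X : Set G) = ⊤)
    {F : ℕ → Finset G} (hF : IsFolnerSequence X F) {n : ℕ}
    (q : (Fin n → MonoidAlgebra k G) →ₗ[MonoidAlgebra k G] M) :
    Tendsto (fun i => (familyRank k (genImage q) (F i : Set G) : ℝ) / (F i).card) atTop
      (𝓝 (infRank q)) := by
  classical
  refine tendsto_iInf_of_le_add (fun E => ?_)
    ⟨fun _ => 0, tendsto_const_nhds, fun i => by
      rw [sub_zero]; exact infRank_le q (hF.nonempty i)⟩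
  refine ⟨fun i => n * (((mulBoundary (E.1.image (·⁻¹)) (F i)).card : ℝ) / (F i).card), ?_,
    fun i => ?_⟩
  · simpa using (hF.tendsto_mulBoundary hX (E.1.image (·⁻¹))).const_mul (n : ℝ)
  · refine div_le_div_add_of_card_mul_le E.2.card_pos (hF.nonempty i).card_pos
      (card_mul_familyRank_le _ _ _ _ _ (fun e he => Finset.mem_image_of_mem _ he)
        fun g _ _ => ?_)
    rw [← familyRank_genImage_translate q g E.1]
    exact familyRank_mono _ Finset.inter_subset_left

theorem IsFolnerSequence.elekDim_eq (hX : Subgroup.closure (X : Set G) = ⊤)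
    {F : ℕ → Finset G} (hF : IsFolnerSequence X F) {n : ℕ}
    (q : (Fin n → MonoidAlgebra k G) →ₗ[MonoidAlgebra k G] M) :
    elekDim F q = infRank q := by
  rw [elekDim, averageDim]
  simp only [finrank_map_restrictTo_range_dualMap]
  exact (hF.tendsto_familyRank hX q).limsup_eq

/-- Ranks with respect to two generating tuples differ by a multiple of a boundary. -/
theorem exists_familyRank_le_add [DecidableEq G] {n s : ℕ}
    (p : (Fin s → MonoidAlgebra k G) →ₗ[MonoidAlgebra k G] M) (hp : Function.Surjective p)
    (q : (Fin n → MonoidAlgebra k G) →ₗ[MonoidAlgebra k G] M) :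
    ∃ B : Finset G, ∀ S : Finset G, familyRank k (genImage q) (S : Set G) ≤
      familyRank k (genImage p) (S : Set G) + s * (mulBoundary B S).card := by
  -- Write q(e_i) = p(y_i) with all y_i supported in B; then q(g e_i) = p(g y_i) lies in the span of
  -- the p(g b e_j) with b ∈ B.
  choose y hy using fun i => hp (genImage q 1 i)
  obtain ⟨B, hB⟩ := exists_forall_mem_familySpan_freeGen y
  refine ⟨B, fun S => ?_⟩
  have h1 : familyRank k (genImage q) (S : Set G) ≤
      familyRank k (genImage p) (Finset.image₂ (· * ·) S B : Finset G) := by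
    refine Submodule.finrank_mono (familySpan_le.2 fun g hg i => ?_)
    have h : genImage q g i = p (groupTranslate k _ g (y i)) := by
      rw [map_groupTranslate, hy, groupTranslate_genImage, mul_one]
    rw [h, familySpan_genImage]
    exact ⟨_, groupTranslate_mem_familySpan g
      (fun x hx => Finset.mem_coe.2 (Finset.mem_image₂_of_mem hg hx)) (hB i), rfl⟩
  refine h1.trans ((familyRank_le_add_sdiff _ S _).trans ?_)
  rw [Fintype.card_fin]
  gcongr
  exact Finset.subset_union_right

/-- Both infima are limits along the same Følner sequence, where the boundary cost of changing
generators vanishes. -/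
theorem IsFolnerSequence.infRank_le_infRank (hX : Subgroup.closure (X : Set G) = ⊤)
    {F : ℕ → Finset G} (hF : IsFolnerSequence X F) {n s : ℕ}
    (p : (Fin s → MonoidAlgebra k G) →ₗ[MonoidAlgebra k G] M) (hp : Function.Surjective p)
    (q : (Fin n → MonoidAlgebra k G) →ₗ[MonoidAlgebra k G] M) :
    infRank q ≤ infRank p := by
  classical
  obtain ⟨B, hB⟩ := exists_familyRank_le_add p hp q
  have h := (hF.tendsto_familyRank hX p).add ((hF.tendsto_mulBoundary hX B).const_mul (s : ℝ))
  rw [mul_zero, add_zero] at h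
  refine le_of_tendsto_of_tendsto' (hF.tendsto_familyRank hX q) h fun i => ?_
  rw [mul_div_assoc', ← add_div]
  gcongr
  exact_mod_cast hB (F i)

end Dimension

/-! ### Truncated presentations -/

section TruncatedPresentation

variable {k G : Type*} [DivisionRing k] [Group G]
  {M : Type*} [AddCommGroup M] [Module k M] [Module (MonoidAlgebra k G) M]
  [IsScalarTower k (MonoidAlgebra k G) M] {r s : ℕ}
  (f : (Fin r → MonoidAlgebra k G) →ₗ[MonoidAlgebra k G] (Fin s → MonoidAlgebra k G))
  (p : (Fin s → MonoidAlgebra k G) →ₗ[MonoidAlgebra k G] M)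

/-- The dimension of `M[F]` is at most that of the image of `k[F]^s` in `kG^s / f(k[F]^r)`. -/
theorem finrank_truncatedCoker_le (F : Finset G) :
    Module.finrank k (truncatedCoker f (F : Set G)) ≤
      familyRank k (fun g i => (familySpan k (genImage f) (F : Set G)).mkQ (freeGen k s g i))
        (F : Set G) := by
  have := finite_groupRingOn (k := k) F
  let φ := (familySpan k (genImage f) (F : Set G)).mkQ ∘ₗ inclOn k (F : Set G) s
  -- If x in k[F]^s equals f(y) with y in k[F]^r, truncation changes nothing and x = pr f(y).
  have hφ : LinearMap.ker φ ≤ LinearMap.range (truncation f (F : Set G)) := by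
    intro x hx
    rw [LinearMap.mem_ker, LinearMap.comp_apply, Submodule.mkQ_apply,
      Submodule.Quotient.mk_eq_zero, familySpan_genImage, ← range_inclOn] at hx
    obtain ⟨_, ⟨y, rfl⟩, hy⟩ := hx
    refine ⟨y, funext fun i => Subtype.ext ?_⟩
    have h1 := congrFun hy i
    change ((projOn k (F : Set G) (f (inclOn k (F : Set G) r y) i)) : MonoidAlgebra k G) = x i
    change f (inclOn k (F : Set G) r y) i = x i at h1
    rw [h1]
    exact projOn_eq_self (x i).2
  have h := finrank_quotient_le_finrank_range φ _ hφ
  rwa [LinearMap.range_comp, range_inclOn, map_familySpan] at h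

variable {f p}

/-- Up to a boundary term, the dimension of `M[F]` is at least that of the image of `k[F]^s`
in `M`. -/
theorem exists_familyRank_le_finrank_truncatedCoker [DecidableEq G]
    (hfp : Function.Exact f p) :
    ∃ B : Finset G, ∀ F : Finset G, familyRank k (genImage p) (F : Set G) ≤
      Module.finrank k (truncatedCoker f (F : Set G)) + r * (mulBoundary B F).card := by
  obtain ⟨B, hB⟩ := exists_forall_mem_familySpan_freeGen (genImage f 1)
  refine ⟨B, fun F => ?_⟩
  have := finite_groupRingOn (k := k) F
  let ψ := p.restrictScalars k ∘ₗ inclOn k (F : Set G) s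
  have h := finrank_range_le_finrank_quotient_add ψ (LinearMap.range (truncation f (F : Set G)))
  let Θ : (Fin r → MonoidAlgebra k G) →ₗ[k] M :=
    ψ ∘ₗ (projOn k (F : Set G)).compLeft (Fin s) ∘ₗ f.restrictScalars k
  have h1 : LinearMap.range ψ = familySpan k (genImage p) (F : Set G) := by
    rw [LinearMap.range_comp, range_inclOn, familySpan_genImage]
  have h2 : (LinearMap.range (truncation f (F : Set G))).map ψ =
      familySpan k (fun g i => Θ (freeGen k r g i)) (F : Set G) := by
    rw [← map_familySpan, ← range_inclOn, ← LinearMap.range_comp, ← LinearMap.range_comp]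
    rfl
  -- If gB ⊆ F, then f(g e_i) is supported in F, so the projection fixes it and Θ(g e_i) = p(f(g
  -- e_i)) = 0. Only border elements contribute.
  have h3 : familySpan k (fun g i => Θ (freeGen k r g i)) (F : Set G) ≤
      familySpan k (fun g i => Θ (freeGen k r g i)) (mulBoundary B F : Set G) := by
    refine familySpan_le.2 fun g hg i => ?_
    by_cases hgB : ∀ b ∈ B, g * b ∈ F
    · have hf : f (freeGen k r g i) ∈ familySpan k (freeGen k s) (F : Set G) := by
        have hgi : f (freeGen k r g i) = groupTranslate k _ g (genImage f 1 i) := by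
          rw [groupTranslate_genImage, mul_one]; rfl
        rw [hgi]
        exact groupTranslate_mem_familySpan g hgB (hB i)
      have hΘ : Θ (freeGen k r g i) = p (f (freeGen k r g i)) :=
        congrArg p (funext fun j => projOn_eq_self (mem_familySpan_freeGen.1 hf j))
      rw [hΘ, (hfp _).2 ⟨_, rfl⟩]
      exact Submodule.zero_mem _
    · push Not at hgB
      exact mem_familySpan (fun g i => Θ (freeGen k r g i)) (Finset.mem_coe.2
        (Finset.mem_union_left _ (Finset.mem_filter.2 ⟨hg, hgB⟩))) i
  have h4 := (Submodule.finrank_mono h3).trans (familyRank_le_card _ _)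
  rw [h1, h2] at h
  rw [Fintype.card_fin] at h4
  exact h.trans (Nat.add_le_add_left h4 _)

/-- Finitely many spanning relations have preimages under f with finite total support. -/
theorem exists_le_familySpan_genImage [DecidableEq G] (K : Submodule k (Fin s → MonoidAlgebra k G))
    (hK : K.FG) (hKf : ∀ y ∈ K, y ∈ Set.range f) :
    ∃ B : Finset G, K ≤ familySpan k (genImage f) (B : Set G) := by
  obtain ⟨t, rfl⟩ := hK
  have h : ∀ y ∈ t, ∃ B : Finset G, y ∈ familySpan k (genImage f) (B : Set G) := by
    intro y hy
    obtain ⟨x, rfl⟩ := hKf y (Submodule.subset_span hy)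
    obtain ⟨B, hB⟩ := exists_mem_familySpan_freeGen x
    exact ⟨B, by rw [familySpan_genImage]; exact ⟨x, hB, rfl⟩⟩
  choose! B hB using h
  exact ⟨t.biUnion B, Submodule.span_le.2 fun y hy => familySpan_mono _
    (Finset.coe_subset.2 (Finset.subset_biUnion_of_mem B hy)) (hB y hy)⟩

/-- Up to a boundary term, the dimension of `M[F]` per point of `F` is at most the normalized
rank of any given finite set `E`. -/
theorem exists_card_mul_finrank_truncatedCoker_le [DecidableEq G] (hfp : Function.Exact f p)
    (E : Finset G) :
    ∃ B : Finset G, ∀ F : Finset G,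
      E.card * Module.finrank k (truncatedCoker f (F : Set G)) ≤
        F.card * familyRank k (genImage p) (E : Set G) +
          (mulBoundary B F).card * (s * E.card) := by
  obtain ⟨E', hE'⟩ := exists_le_familySpan_genImage (f := f)
    (familySpan k (freeGen k s) (E : Set G) ⊓ LinearMap.ker (p.restrictScalars k))
    (Submodule.fg_iff_finiteDimensional _ |>.2 inferInstance) fun y hy => (hfp y).1 hy.2
  refine ⟨E.image (·⁻¹) ∪ E', fun F => ?_⟩
  -- Shearer's inequality is applied in kG^s / f(k[F]^r), where the rank is not translation
  -- invariant. The bound on gE therefore comes from comparison with the invariant rank in M.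
  refine (Nat.mul_le_mul_left _ (finrank_truncatedCoker_le f F)).trans
    (card_mul_familyRank_le _ E F _ _
      (fun e he => Finset.mem_union_left _ (Finset.mem_image_of_mem _ he)) fun g _ hgB => ?_)
  rw [← familyRank_genImage_translate p g E]
  refine (familyRank_mono _ Finset.inter_subset_left).trans ?_
  rw [familyRank, familyRank, familySpan_genImage p,
    ← map_familySpan (familySpan k (genImage f) (F : Set G)).mkQ (freeGen k s)]
  -- It suffices that a relation y of M supported on gE lies in f(k[F]^r). Translating by g⁻¹ gives
  -- a relation x on E, so x = f(z) with z in k[E']^r; then y = f(gz) and gE' ⊆ F.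
  refine finrank_map_le_of_ker_inf_le (p.restrictScalars k) _
    (familySpan k (freeGen k s) ((E.image (g * ·) : Finset G) : Set G)) fun y hy => ?_
  rw [Submodule.ker_mkQ]
  obtain ⟨x, rfl⟩ := (groupTranslate k (Fin s → MonoidAlgebra k G) g).surjective y
  have hx : x ∈ familySpan k (freeGen k s) (E : Set G) := by
    have h := groupTranslate_mem_familySpan g⁻¹ (T := (E : Set G)) (fun z hz => by
      obtain ⟨e, he, rfl⟩ := Finset.mem_image.1 hz
      simpa using he) hy.2
    simpa [groupTranslate, smul_smul, MonoidAlgebra.single_mul_single,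
      ← MonoidAlgebra.one_def] using h
  have hpx : p x = 0 := by
    have h : p (groupTranslate k _ g x) = 0 := hy.1
    rw [map_groupTranslate] at h
    exact (LinearEquiv.map_eq_zero_iff _).1 h
  have h := hE' ⟨hx, hpx⟩
  rw [familySpan_genImage] at h ⊢
  obtain ⟨z, hz, rfl⟩ := h
  exact ⟨groupTranslate k _ g z, groupTranslate_mem_familySpan g
    (fun b hb => hgB b (Finset.mem_union_right _ hb)) hz, map_groupTranslate f g z⟩

end TruncatedPresentation

theorem theorem2p2 {k G : Type*} [DivisionRing k] [Group G]
    (hG : IsAmenableGroup G)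
    (X : Finset G) (hX : Subgroup.closure (X : Set G) = ⊤)
    {M : Type*} [AddCommGroup M] [Module k M] [Module (MonoidAlgebra k G) M]
    [IsScalarTower k (MonoidAlgebra k G) M]
    {r s : ℕ}
    (f : (Fin r → MonoidAlgebra k G) →ₗ[MonoidAlgebra k G] (Fin s → MonoidAlgebra k G))
    (p : (Fin s → MonoidAlgebra k G) →ₗ[MonoidAlgebra k G] M)
    (hfp : Function.Exact f p) (hp : Function.Surjective p)
    {n : ℕ} (q : (Fin n → MonoidAlgebra k G) →ₗ[MonoidAlgebra k G] M)
    (hq : Function.Surjective q)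
    (E : ℕ → Finset G) (hE : IsFolnerSequence X E)
    (F : ℕ → Finset G) (hF : IsFolnerSequence X F) :
    Tendsto
      (fun i => (Module.finrank k (truncatedCoker f (F i : Set G)) : ℝ) / ((F i).card : ℝ))
      atTop (𝓝 (elekDim E q)) := by
  classical
  -- Elek's dimension no longer involves E, and the infimum for `q` is replaced by that for `p`, the
  -- quantity related to M[F].
  rw [hE.elekDim_eq hX q, le_antisymm (hF.infRank_le_infRank hX p hp q)
    (hF.infRank_le_infRank hX q hq p)]
  refine tendsto_iInf_of_le_add (fun A => ?_) ?_
  · obtain ⟨B, hB⟩ := exists_card_mul_finrank_truncatedCoker_le hfp A.1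
    refine ⟨fun i => s * (((mulBoundary B (F i)).card : ℝ) / (F i).card), ?_, fun i =>
      div_le_div_add_of_card_mul_le A.2.card_pos (hF.nonempty i).card_pos (hB (F i))⟩
    simpa using (hF.tendsto_mulBoundary hX B).const_mul (s : ℝ)
  · obtain ⟨B, hB⟩ := exists_familyRank_le_finrank_truncatedCoker (k := k) hfp
    refine ⟨fun i => r * (((mulBoundary B (F i)).card : ℝ) / (F i).card), ?_, fun i => ?_⟩
    · simpa using (hF.tendsto_mulBoundary hX B).const_mul (r : ℝ)
    · rw [sub_le_iff_le_add]
      beta_reduce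
      rw [mul_div_assoc', ← add_div]
      refine (infRank_le p (hF.nonempty i)).trans ?_
      gcongr
      exact_mod_cast hB (F i)
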